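/- Let $f_1,\dots,f_p$ be smooth vector fields on $\mathbb R^d$ vanishing at the origin, and let $V:\mathbb R^d\to[0,\infty)$ be a smooth common weak Lyapunov function: $V(0)=0$, $V(x)>0$ for $x\neq0$, and $L_{f_i}V(x)=dV(x)\cdot f_i(x)\le 0$ for all $i$ and $x$. Put $\mathcal K_i=\{x\in\mathbb R^d : L_{f_i}V(x)=0\}$. An input is a piecewise constant, right-continuous function $u:[0,\infty)\to\{1,\dots,p\}$ whose switching times, if infinitely many, increase to $+\infty$; $\Phi_u(\cdot,x)$ denotes the solution of $\dot x=f_{u(t)}(x)$ starting at $x$, and $J_u$ denotes the set of indices $i$ for which $\{t\ge0 : u(t)=i\}$ has infinite Lebesgue measure. Let $J\subseteq\{1,\dots,p\}$ be nonempty. (a) Suppose that there is a neighbourhood $\mathcal V$ of the origin such that, for every $R>0$, no connected component of $\{V=R\}\cap\mathcal V\cap\bigcup_{i\in J}\mathcal K_i$ intersects all the sets $\mathcal K_i$, $i\in J$. Then the switched system is asymptotically stable at the origin for every input $u$ with $J_u=J$. That is: for every $\delta>0$ there is $\varepsilon>0$ such that, for all $x$ with $\|x\|\le\varepsilon$ and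 all inputs $u$, $\Phi_u(t,x)$ is defined and $\|\Phi_u(t,x)\|\le\delta$ for all $t\ge0$ (uniform stability); and there is $\delta>0$ such that, for all $x$ with $\|x\|\le\delta$ and all inputs $u$ with $J_u=J$, $\Phi_u(t,x)$ is defined for all $t\ge 0$ and $\Phi_u(t,x)\to0$ as $t\to+\infty$. (b) Suppose that the condition in (a) holds with $\mathcal V=\mathbb R^d$ and that, for every $x\in\mathbb R^d$ and every input $u$, the solution $\Phi_u(\cdot,x)$ is defined and bounded on $[0,\infty)$ (which is the case for instance if $V$ is radially unbounded). Then the switched system is globally asymptotically stable at the origin for every input $u$ with $J_u=J$: it is uniformly stable as in (a), and $\Phi_u(t,x)\to0$ as $t\to+\infty$ for every $x\in\mathbb R^d$ and every input $u$ with $J_u=J$. -/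

import Mathlib

open Set Filter Topology MeasureTheory
open scoped ContDiff

namespace SwitchedSystem

/-- The state space `ℝ^d` with its Euclidean norm. -/
abbrev State (d : ℕ) : Type := EuclideanSpace ℝ (Fin d)

/-- The Lie derivative `x ↦ dV(x) · g(x)` of the function `V` along the vector field `g`. -/
noncomputable def lieDeriv {d : ℕ} (g : State d → State d) (V : State d → ℝ) (x : State d) : ℝ :=
  fderiv ℝ V x (g x)

/-- `V` is a smooth common weak Lyapunov function of the vector fields `f i`: it is smooth,
positive definite, and its Lie derivative along each `f i` is nonpositive. -/
structure IsWeakLyapunov {d p : ℕ} (f : Fin p → State d → State d) (V : State d → ℝ) : Prop where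
  smooth : ContDiff ℝ ∞ V
  map_zero : V 0 = 0
  pos : ∀ x, x ≠ 0 → 0 < V x
  lieDeriv_nonpos : ∀ i x, lieDeriv (f i) V x ≤ 0

/-- `u` is an input (switching signal): a piecewise constant, right-continuous function on
`[0, +∞)` with values in the set of indices. Its switching times are terms of a sequence `a` that
starts at `0` and increases strictly to `+∞`, and `u` is constant on each `[a n, a (n + 1))`.
The values of `u` at negative times are irrelevant. -/
def IsInput {p : ℕ} (u : ℝ → Fin p) : Prop :=
  ∃ a : ℕ → ℝ, a 0 = 0 ∧ StrictMono a ∧ Tendsto a atTop atTop ∧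
    ∀ n, ∀ t ∈ Ico (a n) (a (n + 1)), u t = u (a n)

/-- The set `J_u` of the indices `i` such that `{t ≥ 0 | u t = i}` has infinite Lebesgue
measure. -/
def persistentModes {p : ℕ} (u : ℝ → Fin p) : Set (Fin p) :=
  {i | volume {t : ℝ | 0 ≤ t ∧ u t = i} = ⊤}

/-- `φ` is a solution, defined for all `t ≥ 0`, of `x' = f_{u(t)}(x)` starting at `x`. As `u` is
piecewise constant and right-continuous, this means that `φ` is continuous and that its right
derivative at every `t ≥ 0` is `f_{u(t)}(φ(t))`. -/
structure IsSolution {d p : ℕ} (f : Fin p → State d → State d) (u : ℝ → Fin p) (x : State d)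
    (φ : ℝ → State d) : Prop where
  initial : φ 0 = x
  continuousOn : ContinuousOn φ (Ici 0)
  hasDeriv : ∀ t, 0 ≤ t → HasDerivWithinAt φ (f (u t) (φ t)) (Ici t) t

/-- The solution `t ↦ Φ_u(t, x)` exists for all `t ≥ 0` and has the property `P`. (For the smooth
vector fields considered here, the solution is unique on `[0, +∞)`.) -/
def ForwardSolution {d p : ℕ} (f : Fin p → State d → State d) (u : ℝ → Fin p) (x : State d)
    (P : (ℝ → State d) → Prop) : Prop :=
  (∃ φ, IsSolution f u x φ) ∧ ∀ φ, IsSolution f u x φ → P φ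

/-- The solution starting at `x` under the input `u` is forward bounded. -/
def IsForwardBounded {d p : ℕ} (f : Fin p → State d → State d) (u : ℝ → Fin p) (x : State d) :
    Prop :=
  ForwardSolution f u x fun φ => ∃ C : ℝ, ∀ t, 0 ≤ t → ‖φ t‖ ≤ C

/-- Uniform stability at the origin (uniform with respect to all inputs). -/
def IsUniformlyStable {d p : ℕ} (f : Fin p → State d → State d) : Prop :=
  ∀ δ : ℝ, 0 < δ → ∃ ε : ℝ, 0 < ε ∧ ∀ x : State d, ‖x‖ ≤ ε → ∀ u : ℝ → Fin p, IsInput u →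
    ForwardSolution f u x fun φ => ∀ t, 0 ≤ t → ‖φ t‖ ≤ δ

/-- Local attractivity at the origin for the inputs in the class `𝒰`. -/
def IsLocallyAttractiveFor {d p : ℕ} (f : Fin p → State d → State d) (𝒰 : Set (ℝ → Fin p)) :
    Prop :=
  ∃ δ : ℝ, 0 < δ ∧ ∀ x : State d, ‖x‖ ≤ δ → ∀ u ∈ 𝒰,
    ForwardSolution f u x fun φ => Tendsto φ atTop (𝓝 0)

/-- Global attractivity at the origin for the inputs in the class `𝒰`. -/
def IsGloballyAttractiveFor {d p : ℕ} (f : Fin p → State d → State d) (𝒰 : Set (ℝ → Fin p)) :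
    Prop :=
  ∀ u ∈ 𝒰, ∀ x : State d, ForwardSolution f u x fun φ => Tendsto φ atTop (𝓝 0)

/-- Asymptotic stability at the origin for the inputs in the class `𝒰`. -/
def IsAsymptoticallyStableFor {d p : ℕ} (f : Fin p → State d → State d)
    (𝒰 : Set (ℝ → Fin p)) : Prop :=
  IsUniformlyStable f ∧ IsLocallyAttractiveFor f 𝒰

/-- Global asymptotic stability at the origin for the inputs in the class `𝒰`. -/
def IsGloballyAsymptoticallyStableFor {d p : ℕ} (f : Fin p → State d → State d)
    (𝒰 : Set (ℝ → Fin p)) : Prop :=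
  IsUniformlyStable f ∧ IsGloballyAttractiveFor f 𝒰

/-- The set `𝒦_i` where the Lie derivative of `V` along `f i` vanishes. -/
def tangencySet {d p : ℕ} (f : Fin p → State d → State d) (V : State d → ℝ) (i : Fin p) :
    Set (State d) :=
  {x | lieDeriv (f i) V x = 0}

/-- The set `{V = R} ∩ 𝒱 ∩ ⋃_{i ∈ J} 𝒦_i`. -/
def levelTangencySet {d p : ℕ} (f : Fin p → State d → State d) (V : State d → ℝ)
    (J : Set (Fin p)) (𝒱 : Set (State d)) (R : ℝ) : Set (State d) :=
  {x | V x = R} ∩ 𝒱 ∩ ⋃ i ∈ J, tangencySet f V i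

/-- For every `R > 0`, no connected component of `{V = R} ∩ 𝒱 ∩ ⋃_{i ∈ J} 𝒦_i` intersects all the
`𝒦_i`, `i ∈ J`. -/
def ConditionK {d p : ℕ} (f : Fin p → State d → State d) (V : State d → ℝ)
    (J : Set (Fin p)) (𝒱 : Set (State d)) : Prop :=
  ∀ R : ℝ, 0 < R → ∀ x ∈ levelTangencySet f V J 𝒱 R,
    ¬ ∀ i ∈ J, (connectedComponentIn (levelTangencySet f V J 𝒱 R) x ∩ tangencySet f V i).Nonempty

end SwitchedSystem

/-! Along a solution `V` is nonincreasing, so it tends to some `R ≥ 0`. The limit set of a bounded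
solution is nonempty, compact, connected and contained in `{V = R}`. Two facts tie it to the
persistent modes. It meets every such `𝒦_i`: otherwise, by compactness, `V` eventually decreases at
a uniform rate in mode `i`, and `V ≥ 0` bounds the time spent there
(`exists_mem_limitSet_tangencySet`). It lies in the union of these `𝒦_i`: near a limit point
outside, all persistent modes decrease `V` at a uniform rate. The speed is bounded, so each late
visit lasts a fixed time, almost none of it in other modes, whose total time is finite; `V` would
drop below `R` (`limitSet_subset_tangencySet`). If `R > 0`, the limit set thus sits in one component
meeting all the `𝒦_i`, which `ConditionK` forbids; so `R = 0` and the solution tends to the origin.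
-/

namespace SwitchedSystem

/-! ### Limit sets of curves that eventually stay in a compact set -/

section LimitSet

variable {X : Type*} [TopologicalSpace X]

/-- The set of limit points of `φ t` as `t → +∞`. -/
def limitSet (φ : ℝ → X) : Set X := {y | MapClusterPt y atTop φ}

lemma isClosed_limitSet (φ : ℝ → X) : IsClosed (limitSet φ) := isClosed_setOfPred_clusterPt

lemma limitSet_subset_of_eventually_mem {φ : ℝ → X} {K : Set X} (hK : IsClosed K)
    (h : ∀ᶠ t in atTop, φ t ∈ K) : limitSet φ ⊆ K := fun _ hy =>
  hK.mem_of_mapClusterPt hy h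

lemma eventually_mem_of_limitSet_subset {φ : ℝ → X} {K U : Set X} (hK : IsCompact K)
    (h : ∀ᶠ t in atTop, φ t ∈ K) (hU : IsOpen U) (hLU : limitSet φ ⊆ U) :
    ∀ᶠ t in atTop, φ t ∈ U := by
  by_contra hn
  have hfr : ∃ᶠ t in atTop, φ t ∈ K \ U :=
    ((not_eventually.1 hn).and_eventually h).mono fun t ht => ⟨ht.2, ht.1⟩
  obtain ⟨y, hy, hcl⟩ := (hK.diff hU).exists_mapClusterPt_of_frequently hfr
  exact hy.2 (hLU hcl)

lemma limitSet_nonempty {φ : ℝ → X} {K : Set X} (hK : IsCompact K)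
    (h : ∀ᶠ t in atTop, φ t ∈ K) : (limitSet φ).Nonempty := by
  obtain ⟨y, -, hy⟩ := hK.exists_mapClusterPt_of_frequently h.frequently
  exact ⟨y, hy⟩

/-- If disjoint open sets separated two closed pieces of the limit set, a tail of the curve would
lie in their union, hence by connectedness in one of them, and the other piece would be empty. -/
lemma isPreconnected_limitSet [T2Space X] [NormalSpace X] {φ : ℝ → X} {K : Set X}
    (hK : IsCompact K) (h : ∀ᶠ t in atTop, φ t ∈ K) (hφ : ContinuousOn φ (Ici 0)) :
    IsPreconnected (limitSet φ) := by
  rw [isPreconnected_iff_subset_of_fully_disjoint_closed (isClosed_limitSet φ)]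
  intro u v hu hv huv hdisj
  obtain ⟨U, W, hU, hW, huU, hvW, hUW⟩ := normal_separation hu hv hdisj
  have hev : ∀ᶠ t in atTop, φ t ∈ U ∪ W :=
    eventually_mem_of_limitSet_subset hK h (hU.union hW) (huv.trans (union_subset_union huU hvW))
  obtain ⟨T, hT⟩ := (hev.and (eventually_ge_atTop 0)).exists_forall_of_atTop
  have hconn : IsPreconnected (φ '' Ici T) :=
    isPreconnected_Ici.image φ (hφ.mono (Ici_subset_Ici.2 (hT T le_rfl).2))
  have hsub : φ '' Ici T ⊆ U ∪ W := by
    rintro _ ⟨t, ht, rfl⟩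
    exact (hT t ht).1
  have key : ∀ {u v U W : Set X}, limitSet φ ⊆ u ∪ v → v ⊆ W → IsOpen W → Disjoint U W →
      φ '' Ici T ⊆ U → limitSet φ ⊆ u := by
    intro u v U W huv hvW hW hUW hTU y hy
    have : y ∈ Wᶜ := limitSet_subset_of_eventually_mem hW.isClosed_compl
      ((eventually_ge_atTop T).mono fun t ht =>
        disjoint_left.1 hUW (hTU (mem_image_of_mem φ ht))) hy
    exact (huv hy).resolve_right fun hyv => this (hvW hyv)
  rcases isPreconnected_iff_subset_of_disjoint.1 hconn U W hU hW hsub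
    (by simp [hUW.inter_eq]) with h' | h'
  · exact Or.inl (key huv hvW hW hUW h')
  · exact Or.inr (key (by rwa [union_comm]) huU hU hUW.symm h')

end LimitSet

/-! ### Decrease of `V` along solutions -/

section Solutions

variable {d p : ℕ} {f : Fin p → State d → State d} {V : State d → ℝ} {u : ℝ → Fin p}
  {x : State d} {φ : ℝ → State d}

lemma exists_mem_Ico_of_tendsto_atTop {a : ℕ → ℝ} (ha : Tendsto a atTop atTop) {t : ℝ}
    (ht : a 0 ≤ t) : ∃ n, t ∈ Ico (a n) (a (n + 1)) := by
  classical
  have hex : ∃ n, t < a n := (ha.eventually_gt_atTop t).exists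
  obtain ⟨n, hn⟩ : ∃ n, Nat.find hex = n + 1 :=
    Nat.exists_eq_succ_of_ne_zero fun h0 => (h0 ▸ Nat.find_spec hex).not_ge ht
  exact ⟨n, not_lt.1 (Nat.find_min hex (hn ▸ n.lt_succ_self)), hn ▸ Nat.find_spec hex⟩

lemma IsInput.measurableSet (hu : IsInput u) (I : Set (Fin p)) :
    MeasurableSet {t : ℝ | 0 ≤ t ∧ u t ∈ I} := by
  obtain ⟨a, ha0, ham, hat, hau⟩ := hu
  have : {t : ℝ | 0 ≤ t ∧ u t ∈ I} = ⋃ n, ⋃ (_ : u (a n) ∈ I), Ico (a n) (a (n + 1)) := by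
    ext t
    simp only [mem_ofPred_eq, mem_iUnion, exists_prop]
    constructor
    · rintro ⟨h0, hI⟩
      obtain ⟨n, hn⟩ := exists_mem_Ico_of_tendsto_atTop hat (ha0.trans_le h0)
      exact ⟨n, hau n t hn ▸ hI, hn⟩
    · rintro ⟨n, hn, ht⟩
      exact ⟨ha0 ▸ (ham.monotone (Nat.zero_le n)).trans ht.1, by rwa [hau n t ht]⟩
  rw [this]
  exact MeasurableSet.iUnion fun n => MeasurableSet.iUnion fun _ => measurableSet_Ico

lemma IsSolution.hasDerivWithinAt_comp (hV : Differentiable ℝ V) (hφ : IsSolution f u x φ)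
    {t : ℝ} (ht : 0 ≤ t) :
    HasDerivWithinAt (V ∘ φ) (lieDeriv (f (u t)) V (φ t)) (Ici t) t :=
  (hV (φ t)).hasFDerivAt.comp_hasDerivWithinAt t (hφ.hasDeriv t ht)

/-- A weak Lyapunov function decreases at least at rate `c` during the modes in `I`, as long as
their Lie derivatives are at most `-c` along the solution. -/
lemma IsSolution.lyapunov_decrease (hV : IsWeakLyapunov f V) (hu : IsInput u)
    (hφ : IsSolution f u x φ) (I : Set (Fin p)) {c s t : ℝ} (hs : 0 ≤ s) (hst : s ≤ t)
    (hc : ∀ r ∈ Ioo s t, u r ∈ I → lieDeriv (f (u r)) V (φ r) ≤ -c) :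
    V (φ t) ≤ V (φ s) - c * volume.real ({r | 0 ≤ r ∧ u r ∈ I} ∩ Ioc s t) := by
  classical
  set A := {r | 0 ≤ r ∧ u r ∈ I}
  have hA : MeasurableSet A := hu.measurableSet I
  have hint : IntegrableOn (A.indicator fun _ => -c) (Icc s t) :=
    (integrableOn_const (by simp)).indicator hA
  -- This comparison needs only right derivatives, which exist even at switching times.
  have := intervalIntegral.sub_le_integral_of_hasDeriv_right_of_le (g := V ∘ φ)
    (g' := fun r => lieDeriv (f (u r)) V (φ r)) (φ := A.indicator fun _ => -c) hst
    (hV.smooth.continuous.comp_continuousOn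
      (hφ.continuousOn.mono fun r hr => hs.trans hr.1))
    (fun r hr => (hφ.hasDerivWithinAt_comp (hV.smooth.differentiable (by simp))
      (hs.trans hr.1.le)).mono Ioi_subset_Ici_self) hint
    (fun r hr => by
      by_cases hrA : r ∈ A
      · rw [indicator_of_mem hrA]
        exact hc r hr hrA.2
      · rw [indicator_of_notMem hrA]
        exact hV.lieDeriv_nonpos _ _)
  rw [intervalIntegral.integral_of_le hst, setIntegral_indicator hA, setIntegral_const,
    inter_comm] at this
  simp only [Function.comp_apply, smul_eq_mul] at this
  linarith

lemma IsSolution.lyapunov_antitoneOn (hV : IsWeakLyapunov f V) (hu : IsInput u)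
    (hφ : IsSolution f u x φ) : AntitoneOn (V ∘ φ) (Ici 0) := by
  intro s hs t _ hst
  simpa using hφ.lyapunov_decrease hV hu ∅ (c := 0) hs hst (by simp)

end Solutions

/-! ### Limit sets of bounded solutions and convergence to the origin -/

section Attractivity

variable {d p : ℕ} {f : Fin p → State d → State d} {V : State d → ℝ} {u : ℝ → Fin p}
  {x : State d} {φ : ℝ → State d}

lemma continuous_lieDeriv (hV : ContDiff ℝ ∞ V) {g : State d → State d} (hg : Continuous g) :
    Continuous (lieDeriv g V) :=
  (hV.continuous_fderiv (by simp)).clm_apply hg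

lemma IsWeakLyapunov.nonneg (hV : IsWeakLyapunov f V) (y : State d) : 0 ≤ V y := by
  rcases eq_or_ne y 0 with rfl | hy
  · exact hV.map_zero.ge
  · exact (hV.pos y hy).le

/-- A mode along which `V` eventually decreases at a uniform rate is active for a finite time. -/
lemma IsSolution.volume_mode_lt_top (hV : IsWeakLyapunov f V) (hu : IsInput u)
    (hφ : IsSolution f u x φ) {i : Fin p} {c : ℝ} (hc : 0 < c)
    (h : ∀ᶠ t in atTop, lieDeriv (f i) V (φ t) ≤ -c) :
    volume {t : ℝ | 0 ≤ t ∧ u t = i} < ⊤ := by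
  obtain ⟨T, hT⟩ := (h.and (eventually_ge_atTop 0)).exists_forall_of_atTop
  set A := {t : ℝ | 0 ≤ t ∧ u t ∈ ({i} : Set (Fin p))} with hA
  have hbound : ∀ n : ℕ, volume (A ∩ Ioc T (T + n)) ≤ ENNReal.ofReal (V (φ T) / c) := by
    intro n
    have hfin : volume (A ∩ Ioc T (T + n)) ≠ ⊤ :=
      measure_ne_top_of_subset inter_subset_right measure_Ioc_lt_top.ne
    have hdec := hφ.lyapunov_decrease hV hu {i} (c := c) (hT T le_rfl).2
      (le_add_of_nonneg_right n.cast_nonneg) fun r hr hri => by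
        rw [mem_singleton_iff.1 hri]
        exact (hT r hr.1.le).1
    rw [← ENNReal.ofReal_toReal hfin]
    refine ENNReal.ofReal_le_ofReal ?_
    rw [le_div_iff₀ hc]
    have := hV.nonneg (φ (T + n))
    change volume.real _ * c ≤ _
    linarith
  have hcover : {t : ℝ | 0 ≤ t ∧ u t = i} ⊆ Icc 0 T ∪ ⋃ n : ℕ, A ∩ Ioc T (T + n) := by
    rintro t ⟨ht, hti⟩
    rcases le_or_gt t T with htT | htT
    · exact Or.inl ⟨ht, htT⟩
    · obtain ⟨n, hn⟩ := exists_nat_ge (t - T)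
      exact Or.inr (mem_iUnion.2 ⟨n, ⟨ht, hti⟩, htT, by linarith⟩)
  refine (measure_mono hcover).trans_lt ((measure_union_le _ _).trans_lt ?_)
  refine ENNReal.add_lt_top.2 ⟨measure_Icc_lt_top, ?_⟩
  have hmono : Monotone fun n : ℕ => A ∩ Ioc T (T + n) := fun m n hmn =>
    inter_subset_inter_right _ (Ioc_subset_Ioc_right (by gcongr))
  rw [hmono.measure_iUnion]
  exact (iSup_le hbound).trans_lt ENNReal.ofReal_lt_top

/-- The limit set of a bounded solution meets `𝒦_i` for every persistent mode `i`. -/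
lemma IsSolution.exists_mem_limitSet_tangencySet (hf : ∀ i, ContDiff ℝ ∞ (f i))
    (hV : IsWeakLyapunov f V) (hu : IsInput u) (hφ : IsSolution f u x φ) {K : Set (State d)}
    (hK : IsCompact K) (hφK : ∀ t, 0 ≤ t → φ t ∈ K) {i : Fin p} (hi : i ∈ persistentModes u) :
    (limitSet φ ∩ tangencySet f V i).Nonempty := by
  have hev : ∀ᶠ t in atTop, φ t ∈ K := (eventually_ge_atTop 0).mono hφK
  have hcont := continuous_lieDeriv hV.smooth (hf i).continuous
  have hcomp : IsCompact (limitSet φ) :=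
    hK.of_isClosed_subset (isClosed_limitSet φ) (limitSet_subset_of_eventually_mem hK.isClosed hev)
  -- The maximizer of the Lie derivative on the limit set is the witness: were its value negative,
  -- half of it would eventually bound the Lie derivative along `φ`.
  obtain ⟨y, hy, hmax⟩ := hcomp.exists_isMaxOn (limitSet_nonempty hK hev) hcont.continuousOn
  refine ⟨y, hy, le_antisymm (hV.lieDeriv_nonpos i y) (not_lt.1 fun hlt => ?_)⟩
  refine (hφ.volume_mode_lt_top hV hu (i := i) (c := -lieDeriv (f i) V y / 2) (by linarith)
    ?_).ne hi
  refine (eventually_mem_of_limitSet_subset hK hev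
    (isOpen_Iio.preimage hcont : IsOpen (lieDeriv (f i) V ⁻¹' Iio (lieDeriv (f i) V y / 2)))
    fun z hz => ?_).mono fun t ht => ?_
  · have : lieDeriv (f i) V z ≤ lieDeriv (f i) V y := hmax hz
    change lieDeriv (f i) V z < _
    linarith
  · have : lieDeriv (f i) V (φ t) < lieDeriv (f i) V y / 2 := ht
    linarith

lemma IsSolution.dist_le (hφ : IsSolution f u x φ) {M : ℝ}
    (hM : ∀ i, ∀ t, 0 ≤ t → ‖f i (φ t)‖ ≤ M) {s t : ℝ} (hs : 0 ≤ s) (hst : s ≤ t) :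
    dist (φ t) (φ s) ≤ M * (t - s) := by
  rw [dist_eq_norm]
  exact norm_image_sub_le_of_norm_deriv_right_le_segment
    (hφ.continuousOn.mono fun r hr => hs.trans hr.1)
    (fun r hr => hφ.hasDeriv r (hs.trans hr.1)) (fun r hr => hM _ r (hs.trans hr.1)) t ⟨hst, le_rfl⟩

/-- The time spent in non-persistent modes after time `n` tends to `0`. -/
lemma IsInput.tendsto_volume_compl_persistentModes (hu : IsInput u) :
    Tendsto (fun n : ℕ => volume ({t : ℝ | 0 ≤ t ∧ u t ∈ (persistentModes u)ᶜ} ∩ Ici (n : ℝ)))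
      atTop (𝓝 0) := by
  set A := {t : ℝ | 0 ≤ t ∧ u t ∈ (persistentModes u)ᶜ} with hA
  have hfin : volume A ≠ ⊤ := by
    have hcover : A ⊆ ⋃ i ∈ (persistentModes u)ᶜ, {t : ℝ | 0 ≤ t ∧ u t = i} := by
      rintro t ⟨ht, hti⟩
      exact mem_biUnion hti ⟨ht, rfl⟩
    refine ((measure_mono hcover).trans_lt ?_).ne
    exact measure_biUnion_lt_top (toFinite _) fun i hi => lt_top_iff_ne_top.2 hi
  have hmeas := hu.measurableSet (persistentModes u)ᶜ
  have h := tendsto_measure_iInter_atTop (μ := volume) (s := fun n : ℕ => A ∩ Ici (n : ℝ))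
    (fun n => (hmeas.inter measurableSet_Ici).nullMeasurableSet)
    (fun m n hmn => inter_subset_inter_right _ (Ici_subset_Ici.2 (by gcongr)))
    ⟨0, measure_ne_top_of_subset inter_subset_left hfin⟩
  have hempty : ⋂ n : ℕ, A ∩ Ici (n : ℝ) = ∅ := by
    refine eq_empty_of_forall_notMem fun t ht => ?_
    obtain ⟨n, hn⟩ := exists_nat_gt t
    exact (mem_iInter.1 ht n).2.not_gt hn
  rwa [hempty, measure_empty] at h

lemma IsSolution.exists_tendsto_lyapunov (hV : IsWeakLyapunov f V) (hu : IsInput u)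
    (hφ : IsSolution f u x φ) :
    ∃ R, 0 ≤ R ∧ Tendsto (V ∘ φ) atTop (𝓝 R) ∧ ∀ t, 0 ≤ t → R ≤ V (φ t) := by
  have hanti := hφ.lyapunov_antitoneOn hV hu
  have hbdd : BddBelow ((V ∘ φ) '' Ici 0) := ⟨0, by rintro _ ⟨t, -, rfl⟩; exact hV.nonneg _⟩
  set R := sInf ((V ∘ φ) '' Ici 0) with hR
  have hle : ∀ t, 0 ≤ t → R ≤ V (φ t) := fun t ht => csInf_le hbdd (mem_image_of_mem _ ht)
  refine ⟨R, le_csInf ⟨_, mem_image_of_mem _ self_mem_Ici⟩ ?_, ?_, hle⟩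
  · rintro _ ⟨t, -, rfl⟩
    exact hV.nonneg _
  · refine tendsto_order.2 ⟨fun a ha => ?_, fun a ha => ?_⟩
    · exact (eventually_ge_atTop 0).mono fun t ht => ha.trans_le (hle t ht)
    · obtain ⟨_, ⟨s, hs, rfl⟩, hsa⟩ :=
        exists_lt_of_csInf_lt ⟨_, mem_image_of_mem (V ∘ φ) self_mem_Ici⟩ ha
      exact (eventually_ge_atTop s).mono fun t ht =>
        (hanti hs (le_trans hs ht : (0 : ℝ) ≤ t) ht).trans_lt hsa

/-- The limit set of a bounded solution is contained in the union of the `𝒦_i` over the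
persistent modes. -/
lemma IsSolution.limitSet_subset_tangencySet (hf : ∀ i, ContDiff ℝ ∞ (f i))
    (hV : IsWeakLyapunov f V) (hu : IsInput u) (hφ : IsSolution f u x φ) {K : Set (State d)}
    (hK : IsCompact K) (hφK : ∀ t, 0 ≤ t → φ t ∈ K) :
    limitSet φ ⊆ ⋃ i ∈ persistentModes u, tangencySet f V i := by
  intro y hy
  by_contra hyn
  have hneg : ∀ i ∈ persistentModes u, lieDeriv (f i) V y < 0 := fun i hi =>
    lt_of_le_of_ne (hV.lieDeriv_nonpos i y) fun h => hyn (mem_biUnion hi h)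
  have hball : ∀ i, ∃ c > 0, i ∈ persistentModes u → ∀ᶠ z in 𝓝 y, lieDeriv (f i) V z ≤ -c := by
    intro i
    by_cases hi : i ∈ persistentModes u
    · refine ⟨-lieDeriv (f i) V y / 2, by linarith [hneg i hi], fun _ => ?_⟩
      have h := (continuous_lieDeriv hV.smooth (hf i).continuous).continuousAt.eventually_lt_const
        (show lieDeriv (f i) V y < lieDeriv (f i) V y / 2 by linarith [hneg i hi])
      exact h.mono fun z hz => by linarith
    -- A dummy rate, so that the minimum can be taken over all modes.
    · exact ⟨1, one_pos, fun h => (hi h).elim⟩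
  choose c' hc' hball using hball
  obtain ⟨c, hc, hcc'⟩ : ∃ c > 0, ∀ i, c ≤ c' i := by
    have := (u 0)
    obtain ⟨i, hi⟩ := @Finite.exists_min _ _ _ ⟨this⟩ _ c'
    exact ⟨c' i, hc' i, hi⟩
  have hnear : ∀ᶠ z in 𝓝 y, ∀ i, i ∈ persistentModes u → lieDeriv (f i) V z ≤ -c := by
    refine eventually_all.2 fun i => ?_
    by_cases hi : i ∈ persistentModes u
    · exact (hball i hi).mono fun z hz _ => hz.trans (neg_le_neg (hcc' i))
    · exact Eventually.of_forall fun z h => (hi h).elim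
  obtain ⟨r, hr, hrball⟩ := Metric.eventually_nhds_iff.1 hnear
  obtain ⟨M, hMpos, hM⟩ : ∃ M > 0, ∀ i, ∀ t, 0 ≤ t → ‖f i (φ t)‖ ≤ M := by
    choose b hb using fun i => hK.exists_bound_of_continuousOn (hf i).continuous.continuousOn
    refine ⟨1 + ∑ i, |b i|, by positivity, fun i t ht => (hb i _ (hφK t ht)).trans ?_⟩
    have := Finset.single_le_sum (fun j _ => abs_nonneg (b j)) (Finset.mem_univ i)
    linarith [le_abs_self (b i)]
  -- At speed at most `M`, the solution needs time at least `τ` to go from distance `r / 2` of `y`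
  -- to distance `r`.
  set τ := r / (2 * M) with hτ
  have hτpos : 0 < τ := by positivity
  obtain ⟨R, -, hlim, hR⟩ := hφ.exists_tendsto_lyapunov hV hu
  set N := {t : ℝ | 0 ≤ t ∧ u t ∈ (persistentModes u)ᶜ} with hN
  obtain ⟨n, hn⟩ := (hu.tendsto_volume_compl_persistentModes.eventually_lt_const
    (show (0 : ENNReal) < ENNReal.ofReal (τ / 2) by simpa using hτpos)).exists
  -- A visit near `y` so late that `V` exceeds `R` by less than `c * (τ / 2)` and less than `τ / 2`
  -- of non-persistent time remains.
  obtain ⟨t, hty, htR, htn⟩ := ((hy.frequently (Metric.ball_mem_nhds y (half_pos hr))).and_eventually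
    ((hlim.eventually_lt_const (show R < R + c * (τ / 2) by simp; positivity)).and
      (eventually_ge_atTop (n : ℝ)))).exists
  have ht0 : 0 ≤ t := n.cast_nonneg.trans htn
  have hdec := hφ.lyapunov_decrease hV hu (persistentModes u) (c := c) ht0
    (le_add_of_nonneg_right hτpos.le) fun s hs hsp => by
      refine hrball ?_ _ hsp
      have h1 := hφ.dist_le hM ht0 hs.1.le
      have h2 : M * (s - t) < M * τ := by
        gcongr
        linarith [hs.2]
      have h3 : M * τ = r / 2 := by
        rw [hτ]
        field_simp
      calc dist (φ s) y ≤ dist (φ s) (φ t) + dist (φ t) y := dist_triangle _ _ _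
        _ < r := by linarith [Metric.mem_ball.1 hty]
  set P := {s : ℝ | 0 ≤ s ∧ u s ∈ persistentModes u} with hP
  have hvol : τ ≤ volume.real (P ∩ Ioc t (t + τ)) + τ / 2 := by
    have hcover : Ioc t (t + τ) ⊆ (P ∩ Ioc t (t + τ)) ∪ (N ∩ Ici (n : ℝ)) := by
      intro s hs
      have hs0 : 0 ≤ s := ht0.trans hs.1.le
      by_cases hsp : u s ∈ persistentModes u
      · exact Or.inl ⟨⟨hs0, hsp⟩, hs⟩
      · exact Or.inr ⟨⟨hs0, hsp⟩, htn.trans hs.1.le⟩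
    have hfinP : volume (P ∩ Ioc t (t + τ)) ≠ ⊤ :=
      measure_ne_top_of_subset inter_subset_right measure_Ioc_lt_top.ne
    have hNreal : volume.real (N ∩ Ici (n : ℝ)) ≤ τ / 2 :=
      ENNReal.toReal_le_of_le_ofReal (by positivity) hn.le
    calc τ = volume.real (Ioc t (t + τ)) := by simp [hτpos.le]
      _ ≤ volume.real ((P ∩ Ioc t (t + τ)) ∪ (N ∩ Ici (n : ℝ))) :=
        measureReal_mono hcover (measure_union_ne_top hfinP hn.ne_top)
      _ ≤ _ := (measureReal_union_le _ _).trans (by gcongr)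
  have h1 := hR (t + τ) (by positivity)
  have h2 : c * (τ / 2) ≤ c * volume.real (P ∩ Ioc t (t + τ)) := by
    gcongr
    linarith
  have h3 : V (φ t) < R + c * (τ / 2) := htR
  linarith

/-- Under `ConditionK`, bounded solutions staying in `𝒱` converge to the origin. -/
theorem IsSolution.tendsto_zero (hf : ∀ i, ContDiff ℝ ∞ (f i)) (hV : IsWeakLyapunov f V)
    (hu : IsInput u) (hφ : IsSolution f u x φ) {K 𝒱 : Set (State d)} (hK : IsCompact K)
    (hφK : ∀ t, 0 ≤ t → φ t ∈ K) (hK𝒱 : K ⊆ 𝒱) (hcond : ConditionK f V (persistentModes u) 𝒱) :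
    Tendsto φ atTop (𝓝 0) := by
  have hev : ∀ᶠ t in atTop, φ t ∈ K := (eventually_ge_atTop 0).mono hφK
  obtain ⟨R, hR0, hlim, -⟩ := hφ.exists_tendsto_lyapunov hV hu
  have hVR : ∀ y ∈ limitSet φ, V y = R := fun y hy =>
    eq_of_nhds_neBot (ClusterPt.mono
      (MapClusterPt.continuousAt_comp hV.smooth.continuous.continuousAt hy) hlim)
  rcases hR0.eq_or_lt with rfl | hRpos
  · refine hK.tendsto_nhds_of_unique_mapClusterPt hev fun y _ hy => ?_
    by_contra hy0
    exact (hV.pos y hy0).ne' (hVR y hy)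
  · exfalso
    obtain ⟨y, hy⟩ := limitSet_nonempty hK hev
    have hsub : limitSet φ ⊆ levelTangencySet f V (persistentModes u) 𝒱 R := fun z hz =>
      ⟨⟨hVR z hz, hK𝒱 (limitSet_subset_of_eventually_mem hK.isClosed hev hz)⟩,
        hφ.limitSet_subset_tangencySet hf hV hu hK hφK hz⟩
    refine hcond R hRpos y (hsub hy) fun i hi => ?_
    refine (hφ.exists_mem_limitSet_tangencySet hf hV hu hK hφK hi).mono ?_
    exact inter_subset_inter_left _
      ((isPreconnected_limitSet hK hev hφ.continuousOn).subset_connectedComponentIn hy hsub)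

end Attractivity

/-! ### Global existence and uniform stability -/

section Existence

variable {d p : ℕ} {f : Fin p → State d → State d} {V : State d → ℝ} {u : ℝ → Fin p}
  {x : State d} {φ : ℝ → State d}

/-- A compactly supported smooth vector field has integral curves on every compact interval. -/
lemma exists_integralCurve_of_hasCompactSupport {g : State d → State d} (hg : ContDiff ℝ ∞ g)
    (hgc : HasCompactSupport g) {s t : ℝ} (hst : s ≤ t) (x : State d) :
    ∃ α : ℝ → State d, α s = x ∧ ∀ r ∈ Icc s t, HasDerivWithinAt α (g (α r)) (Icc s t) r := by
  obtain ⟨C, hC⟩ := hg.lipschitzWith_of_hasCompactSupport hgc (by simp)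
  obtain ⟨M, hM⟩ := hgc.exists_bound_of_continuous hg.continuous
  have hM0 : 0 ≤ M := (norm_nonneg _).trans (hM 0)
  -- A globally bounded field cannot leave the ball of radius `M * (t - s)`, so Picard–Lindelöf
  -- needs no short interval.
  have hPL : IsPicardLindelof (fun _ => g) (⟨s, le_rfl, hst⟩ : Icc s t) x
      (M.toNNReal * (t - s).toNNReal) 0 M.toNNReal C :=
    { lipschitzOnWith := fun _ _ => hC.lipschitzOnWith
      continuousOn := fun _ _ => continuousOn_const
      norm_le := fun _ _ y _ => (hM y).trans (Real.le_coe_toNNReal M)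
      mul_max_le := by
        simp [hM0, hst] }
  exact hPL.exists_eq_forall_mem_Icc_hasDerivWithinAt₀

lemma IsInput.exists_isSolution_of_hasCompactSupport (hu : IsInput u)
    (hf : ∀ i, ContDiff ℝ ∞ (f i)) (hfc : ∀ i, HasCompactSupport (f i)) (x : State d) :
    ∃ φ, IsSolution f u x φ := by
  obtain ⟨a, ha0, ham, hat, hau⟩ := hu
  have hle : ∀ n, a n ≤ a (n + 1) := fun n => (ham n.lt_succ_self).le
  choose α hα0 hα using fun (n : ℕ) (y : State d) =>
    exists_integralCurve_of_hasCompactSupport (hf (u (a n))) (hfc _) (hle n) y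
  -- The states at the times `a n`, each obtained by flowing the previous one.
  let y : ℕ → State d := fun n => Nat.rec x (fun n z => α n z (a (n + 1))) n
  have hy : ∀ n, y (n + 1) = α n (y n) (a (n + 1)) := fun n => rfl
  have hex : ∀ t : ℝ, ∃ n, 0 ≤ t → t ∈ Ico (a n) (a (n + 1)) := fun t => by
    by_cases ht : 0 ≤ t
    · obtain ⟨n, hn⟩ := exists_mem_Ico_of_tendsto_atTop hat (ha0.trans_le ht)
      exact ⟨n, fun _ => hn⟩
    · exact ⟨0, fun h => (ht h).elim⟩
  choose N hN using hex
  have ha_nonneg : ∀ n, 0 ≤ a n := fun n => ha0 ▸ ham.monotone n.zero_le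
  have hNeq : ∀ n, ∀ t ∈ Ico (a n) (a (n + 1)), N t = n := by
    intro n t ht
    have h := hN t ((ha_nonneg n).trans ht.1)
    have h1 := ham.lt_iff_lt.1 (h.1.trans_lt ht.2)
    have h2 := ham.lt_iff_lt.1 (ht.1.trans_lt h.2)
    omega
  let φ : ℝ → State d := fun t => α (N t) (y (N t)) t
  have hφIco : ∀ n, EqOn φ (α n (y n)) (Ico (a n) (a (n + 1))) := fun n t ht => by
    simp only [φ, hNeq n t ht]
  have hφa : ∀ n, φ (a n) = y n := fun n => by
    rw [hφIco n ⟨le_rfl, ham n.lt_succ_self⟩, hα0]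
  -- At the right endpoint `φ` already follows the next arc, which starts where this one ends.
  have hφIcc : ∀ n, EqOn φ (α n (y n)) (Icc (a n) (a (n + 1))) := fun n t ht => by
    rcases ht.2.eq_or_lt with rfl | hlt
    · rw [hφa, hy]
    · exact hφIco n ⟨ht.1, hlt⟩
  have hcont : ∀ n, ContinuousOn φ (Icc (a n) (a (n + 1))) := fun n =>
    ContinuousOn.congr (fun r hr => (hα n (y n) r hr).continuousWithinAt) (hφIcc n)
  have hcont0 : ∀ n, ContinuousOn φ (Icc 0 (a n)) := by
    intro n
    induction n with
    | zero => simp [ha0]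
    | succ n ih =>
      rw [← Icc_union_Icc_eq_Icc (ha_nonneg n) (hle n)]
      exact ih.union_of_isClosed (hcont n) isClosed_Icc isClosed_Icc
  refine ⟨φ, (congrArg φ ha0.symm).trans (hφa 0), fun t ht => ?_, fun t ht => ?_⟩
  · obtain ⟨n, hn⟩ := (hat.eventually_gt_atTop t).exists
    refine (hcont0 n t ⟨ht, hn.le⟩).mono_of_mem_nhdsWithin ?_
    exact mem_nhdsWithin.2 ⟨Iio (a n), isOpen_Iio, hn, fun s hs => ⟨hs.2, (le_of_lt hs.1)⟩⟩
  · obtain ⟨n, hn⟩ := exists_mem_Ico_of_tendsto_atTop hat (ha0.trans_le ht)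
    rw [hau n t hn]
    have hmem : Icc t (a (n + 1)) ∈ 𝓝[Ici t] t := Icc_mem_nhdsGE hn.2
    have h := (hα n (y n) t ⟨hn.1, hn.2.le⟩).congr_of_mem (hφIcc n) ⟨hn.1, hn.2.le⟩
    rw [← hφIcc n ⟨hn.1, hn.2.le⟩] at h
    exact (h.mono (Icc_subset_Icc_left hn.1)).mono_of_mem_nhdsWithin hmem

/-- A solution starting inside a ball, below the minimum of `V` on its boundary, stays inside. -/
lemma IsSolution.norm_le_of_lyapunov_lt (hV : IsWeakLyapunov f V) (hu : IsInput u)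
    (hφ : IsSolution f u x φ) {δ m : ℝ} (hm : ∀ z : State d, ‖z‖ = δ → m ≤ V z) (hx : ‖x‖ ≤ δ)
    (hxm : V x < m) {t : ℝ} (ht : 0 ≤ t) : ‖φ t‖ ≤ δ := by
  by_contra! hlt
  obtain ⟨s, hs, hsδ⟩ := intermediate_value_Icc ht
    (hφ.continuousOn.norm.mono fun r hr => hr.1 : ContinuousOn (fun r => ‖φ r‖) (Icc 0 t))
    (⟨by rwa [hφ.initial], hlt.le⟩ : δ ∈ Icc ‖φ 0‖ ‖φ t‖)
  have h := hφ.lyapunov_antitoneOn hV hu self_mem_Ici hs.1 hs.1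
  simp only [Function.comp_apply, hφ.initial] at h
  linarith [hm _ hsδ]

lemma IsWeakLyapunov.smul (hV : IsWeakLyapunov f V) {χ : State d → ℝ} (hχ : ∀ z, 0 ≤ χ z) :
    IsWeakLyapunov (fun i z => χ z • f i z) V where
  smooth := hV.smooth
  map_zero := hV.map_zero
  pos := hV.pos
  lieDeriv_nonpos i z := by
    simp only [lieDeriv, map_smul, smul_eq_mul]
    exact mul_nonpos_of_nonneg_of_nonpos (hχ z) (hV.lieDeriv_nonpos i z)

/-- Solutions starting below the minimum `m` of `V` on the sphere of radius `δ` cannot cross it. For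
existence, the fields are cut off outside a ball: `V` remains a weak Lyapunov function, so the
global solution stays where the cutoff is `1`. -/
theorem IsWeakLyapunov.isUniformlyStable (hf : ∀ i, ContDiff ℝ ∞ (f i))
    (hV : IsWeakLyapunov f V) : IsUniformlyStable f := by
  intro δ hδ
  obtain ⟨m, hm0, hm⟩ : ∃ m > 0, ∀ z : State d, ‖z‖ = δ → m ≤ V z := by
    rcases (Metric.sphere (0 : State d) δ).eq_empty_or_nonempty with he | hne
    -- The sphere is empty when `d = 0`.
    · exact ⟨1, one_pos, fun z hz => (he.subset (mem_sphere_zero_iff_norm.2 hz)).elim⟩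
    · obtain ⟨y, hy, hmin⟩ := (isCompact_sphere (0 : State d) δ).exists_isMinOn hne
        hV.smooth.continuous.continuousOn
      refine ⟨V y, hV.pos y ?_, fun z hz => hmin (mem_sphere_zero_iff_norm.2 hz)⟩
      rintro rfl
      simp [hδ.ne] at hy
  have hnear : ∀ᶠ z in 𝓝 (0 : State d), V z < m :=
    hV.smooth.continuous.continuousAt.eventually_lt_const (hV.map_zero.trans_lt hm0)
  obtain ⟨ε, hε, hεm⟩ := Metric.nhds_basis_closedBall.eventually_iff.1 hnear
  refine ⟨min ε δ, lt_min hε hδ, fun x hx u hu => ?_⟩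
  have hxδ : ‖x‖ ≤ δ := hx.trans (min_le_right _ _)
  have hxm : V x < m := hεm (mem_closedBall_zero_iff.2 (hx.trans (min_le_left _ _)))
  refine ⟨?_, fun φ hφ t ht => hφ.norm_le_of_lyapunov_lt hV hu hm hxδ hxm ht⟩
  let χ : ContDiffBump (0 : State d) := ⟨δ, 2 * δ, hδ, by linarith⟩
  obtain ⟨φ, hφ⟩ := hu.exists_isSolution_of_hasCompactSupport (f := fun i z => χ z • f i z)
    (fun i => χ.contDiff.smul (hf i)) (fun i => χ.hasCompactSupport.smul_right) x
  refine ⟨φ, hφ.initial, hφ.continuousOn, fun t ht => ?_⟩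
  have hδt := hφ.norm_le_of_lyapunov_lt (hV.smul fun z => χ.nonneg) hu hm hxδ hxm ht
  have h := hφ.hasDeriv t ht
  rwa [χ.one_of_mem_closedBall (mem_closedBall_zero_iff.2 hδt), one_smul] at h

end Existence

end SwitchedSystem

theorem mainTheorem4 {d p : ℕ}
    (f : Fin p → SwitchedSystem.State d → SwitchedSystem.State d)
    (V : SwitchedSystem.State d → ℝ)
    (hf : ∀ i, ContDiff ℝ ∞ (f i)) (hf0 : ∀ i, f i 0 = 0)
    (hV : SwitchedSystem.IsWeakLyapunov f V)
    (J : Set (Fin p)) (hJ : J.Nonempty) :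
    ((∃ 𝒱 ∈ 𝓝 (0 : SwitchedSystem.State d), SwitchedSystem.ConditionK f V J 𝒱) →
      SwitchedSystem.IsAsymptoticallyStableFor f
        {u | SwitchedSystem.IsInput u ∧ SwitchedSystem.persistentModes u = J}) ∧
    (SwitchedSystem.ConditionK f V J Set.univ →
      (∀ (x : SwitchedSystem.State d) (u : ℝ → Fin p), SwitchedSystem.IsInput u →
        SwitchedSystem.IsForwardBounded f u x) →
      SwitchedSystem.IsGloballyAsymptoticallyStableFor f
        {u | SwitchedSystem.IsInput u ∧ SwitchedSystem.persistentModes u = J}) := by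
  have hstab := hV.isUniformlyStable hf
  refine ⟨?_, fun hcond hbdd => ⟨hstab, ?_⟩⟩
  · rintro ⟨𝒱, h𝒱, hcond⟩
    -- Stability confines small solutions to a closed ball inside `𝒱`, which serves as the compact
    -- set.
    obtain ⟨δ, hδ, hδ𝒱⟩ := Metric.nhds_basis_closedBall.mem_iff.1 h𝒱
    obtain ⟨ε, hε, hεδ⟩ := hstab δ hδ
    refine ⟨hstab, ε, hε, ?_⟩
    rintro x hx u ⟨hu, rfl⟩
    obtain ⟨hex, hle⟩ := hεδ x hx u hu
    exact ⟨hex, fun φ hφ => hφ.tendsto_zero hf hV hu (isCompact_closedBall 0 δ)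
      (fun t ht => mem_closedBall_zero_iff.2 (hle φ hφ t ht)) hδ𝒱 hcond⟩
  · rintro u ⟨hu, rfl⟩ x
    obtain ⟨hex, hle⟩ := hbdd x u hu
    refine ⟨hex, fun φ hφ => ?_⟩
    obtain ⟨C, hC⟩ := hle φ hφ
    exact hφ.tendsto_zero hf hV hu (isCompact_closedBall 0 C)
      (fun t ht => mem_closedBall_zero_iff.2 (hC t ht)) (subset_univ _) hcond
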